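/- **Setting.** Fix integers $K\ge 1$ (users), $N$ (helpers), $N_r$ with $1\le N_r\le N-1$ (resiliency threshold), $T$ with $1\le T\le N$ (maximal number of colluding helpers), and a finite field $\mathbb F_q$. User $k$ holds a gradient $W_k\in\mathbb F_q^{L}$ and private randomness $F_k$; helper $n$ stores a variable $Z_n$ supplied by a trusted third party. The $KL$ gradient symbols are i.i.d. uniform on $\mathbb F_q$, all alphabets are finite, and $W_1,\dots,W_K,F_1,\dots,F_K,(Z_1,\dots,Z_N)$ are mutually independent (the $Z_n$ may be correlated with each other). Put $W=\sum_{k=1}^K W_k$. A *communication pattern* is $\nu=(\mathcal N_1,\dots,\mathcal N_K)$ with $\mathcal N_k\subseteq[N]$, where $\mathcal N_k$ is the set of helpers that receive the message of user $k$; it is *feasible* if $|\mathcal N_k|\ge N_r$ for all $k$. Let $\mathcal N_{\rm UH}=\bigcup_k\mathcal N_k$ be the set of surviving helpers and $\mathcal K_n=\{k: n\in\mathcal N_k\}$. A *scheme* consists of a length $L\ge1$, lengths $L_X,L_Y$, laws of the $F_k$ and of $(Z_1,\dots,Z_N)$, and functions defining * the upload $X_{k,n}\in\mathbb F_q^{L_X}$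 of user $k$ to helper $n$, a function of $(W_k,F_k)$; * for each $\nu$ and distinct $n,n'\in\mathcal N_{\rm UH}$, a message $M^\nu_{n\to n'}$ from helper $n$ to helper $n'$, a function of $(X_{k,n})_{k\in\mathcal K_n}$ and $Z_n$; * for each $\nu$ and $n\in\mathcal N_{\rm UH}$, the response $Y_n^\nu\in\mathbb F_q^{L_Y}$ of helper $n$ to the master, a function of $(X_{k,n})_{k\in\mathcal K_n}$, $Z_n$ and $\mathcal M_n^\nu=(M^\nu_{i\to n})_{i\in\mathcal N_{\rm UH}\setminus\{n\}}$. Helpers outside $\mathcal N_{\rm UH}$ take no part in the exchange between helpers. The scheme must satisfy, for every feasible $\nu$: 1. (correctness) $H(W\mid Y^\nu_{\mathcal A})=0$ for all $\mathcal A\subseteq\mathcal N_{\rm UH}$ with $|\mathcal A|\ge N_r$; 2. (security against helpers) $I(W_{[K]};X_{[K],\mathcal T},Z_{\mathcal T},\mathcal M^\nu_{\mathcal T}\mid W_{\mathcal U},F_{\mathcal U})=0$ for all $\mathcal U\subseteq[K]$ and all $\mathcal T\subseteq[N]$ with $|\mathcal T|\le T$; 3. (security against the master) $I(W_{[K]};Y^\nu_{\mathcal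 N_{\rm UH}},X_{[K],\mathcal T},Z_{\mathcal T},\mathcal M^\nu_{\mathcal T}\mid W,W_{\mathcal U},F_{\mathcal U})=0$ for all $\mathcal U\subseteq[K]$ and all $\mathcal T\subseteq[N]$ with $|\mathcal T|\le T$. A pair $(R_X,R_Y)\in\mathbb R^2$ is *achievable* if some such scheme has $L_X/L\le R_X$ and $L_Y/L\le R_Y$. The *optimal rate region* $\mathcal R^*$ is the closure of the set of achievable pairs. **Theorem.** If $N_r\le T$, then $\mathcal R^*=\emptyset$. If $N_r>T$, then $$\mathcal R^*=\Big\{(R_X,R_Y)\in\mathbb R^2:\ R_X\ge\frac1{N_r-T},\ R_Y\ge\frac1{N_r-T}\Big\}.$$ -/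

import Mathlib

open scoped ENNReal

universe u

noncomputable section

namespace SecureAggregation

section Information

variable {Ω S S' S'' : Type*}

/-- Shannon entropy `H(X)` of a random variable `X` with finite alphabet `S`, where the sample space
`Ω` carries the law `P`. It is measured in nats; the unit plays no role below, since only the
vanishing of information quantities is used. -/
def entropy [Finite S] (P : PMF Ω) (X : Ω → S) : ℝ :=
  ∑' s : S, Real.negMulLog ((P.map X) s).toReal

/-- Conditional entropy `H(X | Y) = H(X, Y) - H(Y)`. -/
def condEntropy [Finite S] [Finite S'] (P : PMF Ω) (X : Ω → S) (Y : Ω → S') : ℝ :=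
  entropy P (fun ω => (X ω, Y ω)) - entropy P Y

/-- Conditional mutual information `I(X ; Y | Z) = H(X | Z) - H(X | Y, Z)`. -/
def condMutualInfo [Finite S] [Finite S'] [Finite S''] (P : PMF Ω)
    (X : Ω → S) (Y : Ω → S') (Z : Ω → S'') : ℝ :=
  condEntropy P X Z - condEntropy P X (fun ω => (Y ω, Z ω))

end Information

/-- The law of a family of independent random variables, the `i`-th of them with law `p i`. -/
def indepLaw {ι A : Type*} [Fintype ι] [Fintype A] (p : ι → PMF A) : PMF (ι → A) := by
  classical
  exact PMF.ofFintype (fun x => ∏ i, p i (x i)) (by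
    have h := Finset.prod_univ_sum (fun _ : ι => (Finset.univ : Finset A)) (fun i a => p i a)
    rw [Fintype.piFinset_univ] at h
    rw [← h]
    refine Finset.prod_eq_one fun i _ => ?_
    rw [← tsum_fintype (L := .unconditional A)]
    exact (p i).tsum_coe)

/-- A user-to-helper communication pattern: `ν k` is the set of helpers that receive the message of
user `k`. -/
abbrev Pattern (K N : ℕ) := Fin K → Finset (Fin N)

namespace Pattern

variable {K N : ℕ}

/-- Every user reaches at least `Nr` helpers. -/
def Feasible (Nr : ℕ) (ν : Pattern K N) : Prop := ∀ k, Nr ≤ (ν k).card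

/-- The helpers that receive a message from at least one user. -/
def survivors (ν : Pattern K N) : Finset (Fin N) := Finset.univ.biUnion ν

/-- The users whose message reaches helper `n`. -/
def heard (ν : Pattern K N) (n : Fin N) : Finset (Fin K) := Finset.univ.filter fun k => n ∈ ν k

end Pattern

/-- A hierarchical aggregation scheme for `K` users and `N` helpers, with gradients of `L` symbols,
user-to-helper messages of `LX` symbols and helper-to-master messages of `LY` symbols over `F`.
All the randomness `F_k` of the users takes values in one finite alphabet, and so do the variables
`Z_n` of the helpers and the messages between helpers. -/
structure Scheme (F : Type u) (K N L LX LY : ℕ) where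
  /-- Alphabet of the randomness generated by a user. -/
  UserRand : Type u
  /-- Alphabet of the randomness stored at a helper. -/
  HelperRand : Type u
  /-- Alphabet of the messages between helpers. -/
  Msg : Type u
  [finUserRand : Fintype UserRand]
  [finHelperRand : Fintype HelperRand]
  [finMsg : Fintype Msg]
  /-- Law of `F_k`. -/
  userLaw : Fin K → PMF UserRand
  /-- Joint law of `(Z_1, …, Z_N)`, which may be arbitrarily correlated. -/
  helperLaw : PMF (Fin N → HelperRand)
  /-- `X_{k,n}` as a function of `W_k` and `F_k`. -/
  upload : Fin K → Fin N → (Fin L → F) → UserRand → (Fin LX → F)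
  /-- The message from helper `n` to helper `n'` under the pattern `ν`, as a function of the user
  messages received by helper `n` and of `Z_n`. -/
  share : (ν : Pattern K N) → (n n' : Fin N) → (ν.heard n → Fin LX → F) → HelperRand → Msg
  /-- The response of helper `n` under the pattern `ν`, as a function of the user messages received
  by helper `n`, of `Z_n`, and of the messages received from the other surviving helpers. -/
  respond : (ν : Pattern K N) → (n : Fin N) → (ν.heard n → Fin LX → F) → HelperRand →
    (ν.survivors.erase n → Msg) → (Fin LY → F)

attribute [instance] Scheme.finUserRand Scheme.finHelperRand Scheme.finMsg

namespace Scheme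

variable {F : Type u} {K N L LX LY : ℕ}

/-- Realizations of `(W_{[K]}, F_{[K]}, Z_{[N]})`. -/
abbrev Outcome (s : Scheme F K N L LX LY) : Type u :=
  (Fin K → Fin L → F) × (Fin K → s.UserRand) × (Fin N → s.HelperRand)

/-- The joint law of `(W_{[K]}, F_{[K]}, Z_{[N]})`: the `K * L` gradient symbols are i.i.d. uniform,
and `W_1, …, W_K, F_1, …, F_K, (Z_1, …, Z_N)` are mutually independent. -/
def law [Fintype F] [Nonempty F] (s : Scheme F K N L LX LY) : PMF s.Outcome :=
  (PMF.uniformOfFintype (Fin K → Fin L → F)).bind fun w =>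
    (indepLaw s.userLaw).bind fun f =>
      s.helperLaw.map fun z => (w, f, z)

/-- `W_{[K]}` -/
def gradients (s : Scheme F K N L LX LY) (ω : s.Outcome) : Fin K → Fin L → F := ω.1

/-- `W = W_1 + ⋯ + W_K` -/
def total [AddCommMonoid F] (s : Scheme F K N L LX LY) (ω : s.Outcome) : Fin L → F :=
  ∑ k, ω.1 k

/-- `X_{k,n}` -/
def X (s : Scheme F K N L LX LY) (k : Fin K) (n : Fin N) (ω : s.Outcome) : Fin LX → F :=
  s.upload k n (ω.1 k) (ω.2.1 k)

/-- `Z_n` -/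
def Z (s : Scheme F K N L LX LY) (n : Fin N) (ω : s.Outcome) : s.HelperRand := ω.2.2 n

/-- The user messages received by helper `n` under the pattern `ν`. -/
def received (s : Scheme F K N L LX LY) (ν : Pattern K N) (n : Fin N) (ω : s.Outcome) :
    ν.heard n → Fin LX → F :=
  fun k => s.X k n ω

/-- The message from helper `n` to helper `n'` under the pattern `ν`. -/
def M (s : Scheme F K N L LX LY) (ν : Pattern K N) (n n' : Fin N) (ω : s.Outcome) : s.Msg :=
  s.share ν n n' (s.received ν n ω) (s.Z n ω)

/-- The messages that helper `n` receives from the other surviving helpers. -/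
def inbox (s : Scheme F K N L LX LY) (ν : Pattern K N) (n : Fin N) (ω : s.Outcome) :
    ν.survivors.erase n → s.Msg :=
  fun i => s.M ν i n ω

/-- The response of helper `n` under the pattern `ν`. -/
def Y (s : Scheme F K N L LX LY) (ν : Pattern K N) (n : Fin N) (ω : s.Outcome) : Fin LY → F :=
  s.respond ν n (s.received ν n ω) (s.Z n ω) (s.inbox ν n ω)

/-- The responses of the helpers in `A`. -/
def responses (s : Scheme F K N L LX LY) (ν : Pattern K N) (A : Finset (Fin N)) (ω : s.Outcome) :
    A → Fin LY → F :=
  fun n => s.Y ν n ω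

/-- What the colluding helpers in `𝒯` know: all user messages addressed to them (straggling or not),
their stored randomness, and the messages they get from other helpers. Only surviving helpers take
part in the exchange between helpers. -/
def helperView (s : Scheme F K N L LX LY) (ν : Pattern K N) (𝒯 : Finset (Fin N)) (ω : s.Outcome) :
    (Fin K → 𝒯 → Fin LX → F) × (𝒯 → s.HelperRand) ×
      ((n : ↥(𝒯 ∩ ν.survivors)) → ν.survivors.erase (n : Fin N) → s.Msg) :=
  (fun k n => s.X k n ω, fun n => s.Z n ω, fun n => s.inbox ν n ω)

/-- What the colluding users in `𝒰` know: `(W_𝒰, F_𝒰)`. -/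
def userView (s : Scheme F K N L LX LY) (𝒰 : Finset (Fin K)) (ω : s.Outcome) :
    (𝒰 → Fin L → F) × (𝒰 → s.UserRand) :=
  (fun k => ω.1 k, fun k => ω.2.1 k)

section Constraints

variable [Field F] [Fintype F]

/-- Correctness: `H(W | Y_A) = 0` for every set `A` of at least `Nr` surviving helpers. -/
def Correct (s : Scheme F K N L LX LY) (Nr : ℕ) : Prop :=
  ∀ ν : Pattern K N, ν.Feasible Nr → ∀ A : Finset (Fin N), A ⊆ ν.survivors → Nr ≤ A.card →
    condEntropy s.law s.total (s.responses ν A) = 0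

/-- Security against at most `T` colluding helpers and any set of colluding users. -/
def SecureHelpers (s : Scheme F K N L LX LY) (Nr T : ℕ) : Prop :=
  ∀ ν : Pattern K N, ν.Feasible Nr → ∀ 𝒰 : Finset (Fin K),
    ∀ 𝒯 : Finset (Fin N), 𝒯.card ≤ T →
      condMutualInfo s.law s.gradients (s.helperView ν 𝒯) (s.userView 𝒰) = 0

/-- Security against the master colluding with at most `T` helpers and any set of users. -/
def SecureMaster (s : Scheme F K N L LX LY) (Nr T : ℕ) : Prop :=
  ∀ ν : Pattern K N, ν.Feasible Nr → ∀ 𝒰 : Finset (Fin K),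
    ∀ 𝒯 : Finset (Fin N), 𝒯.card ≤ T →
      condMutualInfo s.law s.gradients
        (fun ω => (s.responses ν ν.survivors ω, s.helperView ν 𝒯 ω))
        (fun ω => (s.total ω, s.userView 𝒰 ω)) = 0

end Constraints

end Scheme

/-- The rate tuple `R = (R_X, R_Y)` is achievable: for some gradient length `L ≥ 1` there is a
correct and secure scheme with `LX / L ≤ R_X` and `LY / L ≤ R_Y`. -/
def Achievable (F : Type u) [Field F] [Fintype F] (K N Nr T : ℕ) (R : ℝ × ℝ) : Prop :=
  ∃ (L LX LY : ℕ) (s : Scheme F K N L LX LY), 0 < L ∧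
    s.Correct Nr ∧ s.SecureHelpers Nr T ∧ s.SecureMaster Nr T ∧
    (LX : ℝ) / (L : ℝ) ≤ R.1 ∧ (LY : ℝ) / (L : ℝ) ≤ R.2

/-- The optimal rate region: the closure of the set of achievable rate tuples. -/
def optimalRegion (F : Type u) [Field F] [Fintype F] (K N Nr T : ℕ) : Set (ℝ × ℝ) :=
  closure {R : ℝ × ℝ | Achievable F K N Nr T R}

end SecureAggregation

end

/-!
The pattern in which all users reach the same `Nr` helpers `A` gives the converse. There the sum of
the gradients is a function of the responses of `A`. A vanishing mutual information means that what
any `T` helpers see is compatible with every choice of the gradients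
(`Scheme.SecureHelpers.exists_gradients_eq`), so counting possible values replaces all entropy
inequalities. If `Nr ≤ T`, then `A` itself is such a set of helpers and the sum would be constant
(`Scheme.threshold_lt`). If `T < Nr`, fix what `T` helpers of `A` see: the `q ^ L` possible sums are
still told apart by the `Nr - T` other responses (`Scheme.length_le_response`). For the uploads one
keeps all other users and all stored variables fixed as well, which independence permits, and the
gradient of one user has to be told apart by its messages to the `Nr - T` other helpers
(`Scheme.length_le_upload`).

For the direct part, the uploads are ramp secret shares of the gradients: values, at `N` points of
an extension field of degree `m`, of a polynomial of degree less than `Nr` whose values at `Nr - T`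
further points are the gradient and whose values at `T` more points are random
(`exists_rampSharing`). The helpers compute the shares of the sum. Since helper `n` may have missed
some users, the other helpers send it their terms of the Lagrange formula that recovers its missing
shares from the shares that were received, hidden by stored masks that sum to zero. Then `L` is
`(Nr - T) * m` while uploads and responses have `m` symbols, so the corner point of the region is
attained exactly.

Security of this linear scheme is a symmetry argument: a change of the gradients is compensated by a
translation of the randomness which changes nothing in the view of `T` helpers, and nothing in the
responses if the sum is unchanged (`RampSharing.exists_compensation`); such translations preserve
the law, which gives conditional independence (`condMutualInfo_eq_zero`).
-/

namespace SecureAggregation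

/-! ### Entropy on a finite sample space -/

section Information

variable {Ω S S' S'' : Type*}

theorem toReal_pos_of_mem_support {P : PMF Ω} {ω : Ω} (h : ω ∈ P.support) : 0 < (P ω).toReal :=
  ENNReal.toReal_pos ((P.mem_support_iff ω).1 h) (P.apply_ne_top ω)

theorem toReal_eq_zero_of_notMem_support {P : PMF Ω} {ω : Ω} (h : ω ∉ P.support) :
    (P ω).toReal = 0 := by
  rw [(P.apply_eq_zero_iff ω).2 h, ENNReal.toReal_zero]

variable [Fintype Ω]

open Classical in
/-- The probability of the event `X = s`, as a finite sum of real numbers. -/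
noncomputable def mass (P : PMF Ω) (X : Ω → S) (s : S) : ℝ :=
  ∑ ω, if X ω = s then (P ω).toReal else 0

theorem toReal_map_apply (P : PMF Ω) (X : Ω → S) (s : S) :
    ((P.map X) s).toReal = mass P X s := by
  classical
  rw [PMF.map_apply, tsum_fintype, ENNReal.toReal_sum]
  · refine Finset.sum_congr rfl fun ω _ => ?_
    by_cases h : X ω = s
    · simp [h]
    · simp [h, Ne.symm h]
  · intro ω _
    split_ifs
    · exact P.apply_ne_top ω
    · simp

theorem mass_nonneg (P : PMF Ω) (X : Ω → S) (s : S) : 0 ≤ mass P X s :=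
  Finset.sum_nonneg fun ω _ => by split_ifs <;> simp

theorem sum_toReal (P : PMF Ω) : ∑ ω, (P ω).toReal = 1 := by
  have h := P.tsum_coe
  rw [tsum_fintype] at h
  rw [← ENNReal.toReal_sum fun ω _ => P.apply_ne_top ω, h, ENNReal.toReal_one]

theorem mass_pos {P : PMF Ω} {ω : Ω} (h : ω ∈ P.support) (X : Ω → S) : 0 < mass P X (X ω) := by
  classical
  refine Finset.sum_pos' (fun ω _ => by split_ifs <;> simp) ⟨ω, Finset.mem_univ _, ?_⟩
  rw [if_pos rfl]
  exact toReal_pos_of_mem_support h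

theorem exists_mem_support_of_mass_ne_zero {P : PMF Ω} {X : Ω → S} {s : S}
    (h : mass P X s ≠ 0) : ∃ ω ∈ P.support, X ω = s := by
  classical
  obtain ⟨ω, -, hω⟩ := Finset.exists_ne_zero_of_sum_ne_zero h
  by_cases hX : X ω = s
  · refine ⟨ω, ?_, hX⟩
    by_contra hs
    rw [if_pos hX, toReal_eq_zero_of_notMem_support hs] at hω
    exact hω rfl
  · rw [if_neg hX] at hω
    exact absurd rfl hω

theorem sum_mass [Fintype S] (P : PMF Ω) (X : Ω → S) : ∑ s, mass P X s = 1 := by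
  classical
  unfold mass
  rw [Finset.sum_comm, ← sum_toReal P]
  refine Finset.sum_congr rfl fun ω _ => ?_
  simp

theorem sum_mass_prodMk_left [Fintype S] (P : PMF Ω) (X : Ω → S) (Y : Ω → S') (y : S') :
    ∑ x, mass P (fun ω => (X ω, Y ω)) (x, y) = mass P Y y := by
  classical
  unfold mass
  rw [Finset.sum_comm]
  refine Finset.sum_congr rfl fun ω _ => ?_
  by_cases h : Y ω = y <;> simp [h]

theorem sum_mass_prodMk_middle [Fintype S'] (P : PMF Ω) (X : Ω → S) (Y : Ω → S') (Z : Ω → S'')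
    (x : S) (z : S'') :
    ∑ y, mass P (fun ω => (X ω, Y ω, Z ω)) (x, y, z) = mass P (fun ω => (X ω, Z ω)) (x, z) := by
  classical
  unfold mass
  rw [Finset.sum_comm]
  refine Finset.sum_congr rfl fun ω _ => ?_
  by_cases h : X ω = x <;> by_cases h' : Z ω = z <;> simp [h, h']

theorem entropy_eq_sum [Finite S] (P : PMF Ω) (X : Ω → S) :
    entropy P X = -∑ ω, (P ω).toReal * Real.log (mass P X (X ω)) := by
  classical
  have := Fintype.ofFinite S
  unfold entropy
  rw [tsum_fintype]
  simp_rw [toReal_map_apply, Real.negMulLog]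
  have h : ∀ s, -mass P X s * Real.log (mass P X s) =
      ∑ ω, if X ω = s then -((P ω).toReal * Real.log (mass P X (X ω))) else 0 := by
    intro s
    conv_lhs => rw [neg_mul]; arg 1; arg 1; unfold mass
    rw [Finset.sum_mul, ← Finset.sum_neg_distrib]
    refine Finset.sum_congr rfl fun ω _ => ?_
    split_ifs with hs
    · rw [hs]
    · simp
  simp_rw [h]
  rw [Finset.sum_comm, ← Finset.sum_neg_distrib]
  refine Finset.sum_congr rfl fun ω _ => ?_
  simp

theorem condEntropy_eq_sum [Finite S] [Finite S'] (P : PMF Ω) (X : Ω → S) (Y : Ω → S') :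
    condEntropy P X Y = ∑ ω, (P ω).toReal * (Real.log (mass P Y (Y ω)) -
      Real.log (mass P (fun ω => (X ω, Y ω)) (X ω, Y ω))) := by
  simp only [condEntropy, entropy_eq_sum, mul_sub, Finset.sum_sub_distrib]
  ring

theorem mass_prodMk_le (P : PMF Ω) (X : Ω → S) (Y : Ω → S') (x : S) (y : S') :
    mass P (fun ω => (X ω, Y ω)) (x, y) ≤ mass P Y y := by
  classical
  refine Finset.sum_le_sum fun ω _ => ?_
  by_cases h : Y ω = y <;> by_cases h' : X ω = x <;> simp [h, h']

/-- `H(X | Y) = 0` as soon as `Y` determines `X` almost surely. -/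
theorem condEntropy_eq_zero [Finite S] [Finite S'] {P : PMF Ω} {X : Ω → S} {Y : Ω → S'}
    (h : ∀ ω ∈ P.support, ∀ ω' ∈ P.support, Y ω = Y ω' → X ω = X ω') :
    condEntropy P X Y = 0 := by
  classical
  rw [condEntropy_eq_sum]
  refine Finset.sum_eq_zero fun ω _ => ?_
  by_cases hω : ω ∈ P.support
  · have : mass P Y (Y ω) = mass P (fun ω => (X ω, Y ω)) (X ω, Y ω) := by
      refine Finset.sum_congr rfl fun ω' _ => ?_
      by_cases hω' : ω' ∈ P.support
      · by_cases hY : Y ω' = Y ω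
        · simp [hY, h ω' hω' ω hω hY]
        · simp [hY]
      · simp [toReal_eq_zero_of_notMem_support hω']
    rw [this, sub_self, mul_zero]
  · rw [toReal_eq_zero_of_notMem_support hω, zero_mul]

/-- If `H(X | Y) = 0` then `Y` determines `X` almost surely. -/
theorem eq_of_condEntropy_eq_zero [Finite S] [Finite S'] {P : PMF Ω} {X : Ω → S} {Y : Ω → S'}
    (h : condEntropy P X Y = 0) {ω ω' : Ω} (hω : ω ∈ P.support) (hω' : ω' ∈ P.support)
    (hY : Y ω = Y ω') : X ω = X ω' := by
  classical
  have := Fintype.ofFinite S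
  rw [condEntropy_eq_sum] at h
  have hnn : ∀ ω ∈ Finset.univ, 0 ≤ (P ω).toReal * (Real.log (mass P Y (Y ω)) -
      Real.log (mass P (fun ω => (X ω, Y ω)) (X ω, Y ω))) := by
    intro ω _
    by_cases hs : ω ∈ P.support
    · exact mul_nonneg ENNReal.toReal_nonneg (sub_nonneg.2
        (Real.log_le_log (mass_pos hs _) (mass_prodMk_le P X Y _ _)))
    · rw [toReal_eq_zero_of_notMem_support hs, zero_mul]
  have h0 := (Finset.sum_eq_zero_iff_of_nonneg hnn).1 h ω (Finset.mem_univ _)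
  have h1 := (mul_eq_zero.1 h0).resolve_left (toReal_pos_of_mem_support hω).ne'
  have h2 : mass P Y (Y ω) = mass P (fun ω => (X ω, Y ω)) (X ω, Y ω) :=
    Real.log_injOn_pos (mass_pos hω Y) (mass_pos hω fun ω => (X ω, Y ω)) (sub_eq_zero.1 h1)
  by_contra hne
  have h3 := Finset.sum_le_sum_of_subset_of_nonneg (Finset.subset_univ {X ω, X ω'})
    fun x _ _ => mass_nonneg P (fun ω => (X ω, Y ω)) (x, Y ω)
  rw [sum_mass_prodMk_left, Finset.sum_pair hne, h2, hY] at h3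
  have h4 := mass_pos hω' fun ω => (X ω, Y ω)
  linarith

theorem condMutualInfo_eq_sum [Finite S] [Finite S'] [Finite S''] (P : PMF Ω) (X : Ω → S)
    (Y : Ω → S') (Z : Ω → S'') :
    condMutualInfo P X Y Z = ∑ ω, (P ω).toReal *
      (Real.log (mass P (fun ω => (X ω, Y ω, Z ω)) (X ω, Y ω, Z ω)) + Real.log (mass P Z (Z ω))
        - Real.log (mass P (fun ω => (X ω, Z ω)) (X ω, Z ω))
        - Real.log (mass P (fun ω => (Y ω, Z ω)) (Y ω, Z ω))) := by
  simp only [condMutualInfo, condEntropy_eq_sum, mul_sub, mul_add, Finset.sum_sub_distrib,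
    Finset.sum_add_distrib]
  ring

/-- The symmetry criterion for conditional independence: `I(X ; Y | Z) = 0` if any two values of `X`
that are compatible with the same value of `Z` are exchanged by a bijection of the sample space
that preserves the law and fixes both `Y` and `Z`. -/
theorem condMutualInfo_eq_zero [Finite S] [Finite S'] [Finite S''] {P : PMF Ω} {X : Ω → S}
    {Y : Ω → S'} {Z : Ω → S''}
    (h : ∀ ω₁ ω₂ : Ω, Z ω₁ = Z ω₂ → ∃ σ : Ω ≃ Ω, (∀ ω, P (σ ω) = P ω) ∧
      (∀ ω, X ω = X ω₁ → X (σ ω) = X ω₂) ∧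
      ∀ ω, Y (σ ω) = Y ω ∧ Z (σ ω) = Z ω) :
    condMutualInfo P X Y Z = 0 := by
  classical
  have := Fintype.ofFinite S
  have := Fintype.ofFinite S'
  have hle : ∀ ω₁ ω₂ : Ω, Z ω₁ = Z ω₂ → ∀ y z,
      mass P (fun ω => (X ω, Y ω, Z ω)) (X ω₁, y, z) ≤
        mass P (fun ω => (X ω, Y ω, Z ω)) (X ω₂, y, z) := by
    intro ω₁ ω₂ h12 y z
    obtain ⟨σ, hP, hX, hYZ⟩ := h ω₁ ω₂ h12
    simp only [mass]
    refine le_trans (Finset.sum_le_sum fun ω _ => ?_) (Equiv.sum_comp σ _).le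
    beta_reduce
    by_cases hx : X ω = X ω₁
    · rw [hP, hX ω hx, (hYZ ω).1, (hYZ ω).2]
      simp [hx]
    · simp only [Prod.mk.injEq, hx, false_and, if_false]
      split_ifs <;> simp
  have heq : ∀ ω₁ ω₂ : Ω, Z ω₁ = Z ω₂ → ∀ y z,
      mass P (fun ω => (X ω, Y ω, Z ω)) (X ω₁, y, z) =
        mass P (fun ω => (X ω, Y ω, Z ω)) (X ω₂, y, z) := fun ω₁ ω₂ h12 y z =>
    le_antisymm (hle ω₁ ω₂ h12 y z) (hle ω₂ ω₁ h12.symm y z)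
  -- Both sides of the product formula are sums over the values `x'` of `X`; they agree termwise.
  have hprod : ∀ ω, mass P (fun ω => (X ω, Y ω, Z ω)) (X ω, Y ω, Z ω) * mass P Z (Z ω) =
      mass P (fun ω => (X ω, Z ω)) (X ω, Z ω) * mass P (fun ω => (Y ω, Z ω)) (Y ω, Z ω) := by
    intro ω
    rw [← sum_mass_prodMk_left P X Z, ← sum_mass_prodMk_left P X fun ω => (Y ω, Z ω),
      Finset.mul_sum, Finset.mul_sum]
    refine Finset.sum_congr rfl fun x' _ => ?_
    by_cases hx' : ∃ ω', X ω' = x' ∧ Z ω' = Z ω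
    · obtain ⟨ω', rfl, hz⟩ := hx'
      rw [← sum_mass_prodMk_middle P X Y Z, ← sum_mass_prodMk_middle P X Y Z, heq ω' ω hz, mul_comm]
      congr 1
      exact Finset.sum_congr rfl fun y _ => heq ω' ω hz y _
    · have h1 : mass P (fun ω => (X ω, Z ω)) (x', Z ω) = 0 := by
        by_contra hne
        obtain ⟨ω', -, hω'⟩ := exists_mem_support_of_mass_ne_zero hne
        exact hx' ⟨ω', (Prod.mk.inj hω').1, (Prod.mk.inj hω').2⟩
      have h2 : mass P (fun ω => (X ω, Y ω, Z ω)) (x', Y ω, Z ω) = 0 := by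
        by_contra hne
        obtain ⟨ω', -, hω'⟩ := exists_mem_support_of_mass_ne_zero hne
        exact hx' ⟨ω', (Prod.mk.inj hω').1, (Prod.mk.inj (Prod.mk.inj hω').2).2⟩
      rw [h1, h2, mul_zero, mul_zero]
  rw [condMutualInfo_eq_sum]
  refine Finset.sum_eq_zero fun ω _ => ?_
  by_cases hω : ω ∈ P.support
  · have h1 := mass_pos hω fun ω => (X ω, Y ω, Z ω)
    have h2 := mass_pos hω Z
    have h3 := mass_pos hω fun ω => (X ω, Z ω)
    have h4 := mass_pos hω fun ω => (Y ω, Z ω)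
    rw [← Real.log_mul h1.ne' h2.ne', hprod ω, Real.log_mul h3.ne' h4.ne']
    ring
  · rw [toReal_eq_zero_of_notMem_support hω, zero_mul]

/-- If `I(X ; Y | Z) = 0` with `Z` constant, then every value of `X` of positive probability occurs
together with every value of `Y` of positive probability. This is the equality case of Gibbs'
inequality, of which only the assertion about the supports is needed. -/
theorem exists_of_condMutualInfo_eq_zero [Finite S] [Finite S'] [Subsingleton S'']
    [Finite S''] {P : PMF Ω} {X : Ω → S} {Y : Ω → S'} {Z : Ω → S''}
    (h : condMutualInfo P X Y Z = 0) {ω₁ ω₂ : Ω} (h₁ : ω₁ ∈ P.support) (h₂ : ω₂ ∈ P.support) :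
    ∃ ω ∈ P.support, X ω = X ω₁ ∧ Y ω = Y ω₂ := by
  classical
  have := Fintype.ofFinite S
  have := Fintype.ofFinite S'
  set p : S × S' → ℝ := mass P fun ω => (X ω, Y ω) with hp
  have hXYZ : ∀ ω, mass P (fun ω => (X ω, Y ω, Z ω)) (X ω, Y ω, Z ω) = p (X ω, Y ω) := fun ω => by
    simp [hp, mass, Subsingleton.elim _ (Z ω)]
  have hXZ : ∀ ω, mass P (fun ω => (X ω, Z ω)) (X ω, Z ω) = mass P X (X ω) := fun ω => by
    simp [mass, Subsingleton.elim _ (Z ω)]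
  have hYZ : ∀ ω, mass P (fun ω => (Y ω, Z ω)) (Y ω, Z ω) = mass P Y (Y ω) := fun ω => by
    simp [mass, Subsingleton.elim _ (Z ω)]
  have hZ : ∀ ω, mass P Z (Z ω) = 1 := fun ω => by
    rw [← sum_toReal P]
    simp [mass, Subsingleton.elim _ (Z ω)]
  rw [condMutualInfo_eq_sum] at h
  simp only [hXYZ, hXZ, hYZ, hZ, Real.log_one, add_zero] at h
  by_contra hne
  push Not at hne
  have hp0 : p (X ω₁, Y ω₂) = 0 := by
    by_contra h0
    obtain ⟨ω, hω, he⟩ := exists_mem_support_of_mass_ne_zero h0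
    exact hne ω hω (Prod.mk.inj he).1 (Prod.mk.inj he).2
  -- `t = p(x) p(y) / p(x, y)`, for which `log t ≤ t - 1`; the expectation of `t` is the total mass
  -- of the product of the marginals on the support of the joint law.
  set q : S × S' → ℝ := fun s => mass P X s.1 * mass P Y s.2 with hq
  have hterm : ∀ ω, (P ω).toReal - (P ω).toReal * (q (X ω, Y ω) / p (X ω, Y ω)) ≤
      (P ω).toReal * (Real.log (p (X ω, Y ω)) - Real.log (mass P X (X ω)) -
        Real.log (mass P Y (Y ω))) := by
    intro ω
    by_cases hω : ω ∈ P.support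
    · have h1 : 0 < p (X ω, Y ω) := mass_pos hω fun ω => (X ω, Y ω)
      have h2 := mass_pos hω X
      have h3 := mass_pos hω Y
      have h4 := Real.log_le_sub_one_of_pos (div_pos (mul_pos h2 h3) h1)
      rw [Real.log_div (mul_pos h2 h3).ne' h1.ne', Real.log_mul h2.ne' h3.ne'] at h4
      have h5 := toReal_pos_of_mem_support hω
      simp only [hq]
      nlinarith
    · rw [toReal_eq_zero_of_notMem_support hω]
      simp
  have hsum := Finset.sum_le_sum fun ω (_ : ω ∈ Finset.univ) => hterm ω
  rw [h, Finset.sum_sub_distrib, sum_toReal] at hsum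
  have hexp : ∑ ω, (P ω).toReal * (q (X ω, Y ω) / p (X ω, Y ω)) =
      ∑ s, if p s = 0 then 0 else q s := by
    have : ∀ s, (if p s = 0 then 0 else q s) =
        ∑ ω, if (X ω, Y ω) = s then (P ω).toReal * (q (X ω, Y ω) / p (X ω, Y ω)) else 0 := by
      intro s
      have : p s * (q s / p s) =
          ∑ ω, if (X ω, Y ω) = s then (P ω).toReal * (q (X ω, Y ω) / p (X ω, Y ω)) else 0 := by
        conv_lhs => arg 1; rw [hp]; unfold mass
        rw [Finset.sum_mul]
        refine Finset.sum_congr rfl fun ω _ => ?_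
        split_ifs with hs
        · rw [← hs]
        · simp
      rw [← this]
      split_ifs with h0
      · simp [h0]
      · field_simp
    simp_rw [this]
    rw [Finset.sum_comm]
    refine Finset.sum_congr rfl fun ω _ => ?_
    simp
  have hqsum : ∑ s, q s = 1 := by
    simp only [hq]
    rw [Fintype.sum_prod_type, ← Finset.sum_mul_sum, sum_mass, sum_mass, one_mul]
  have hqpos : 0 < q (X ω₁, Y ω₂) := mul_pos (mass_pos h₁ X) (mass_pos h₂ Y)
  have hlt : ∑ s, (if p s = 0 then 0 else q s) < ∑ s, q s := by
    refine Finset.sum_lt_sum (fun s _ => ?_) ⟨(X ω₁, Y ω₂), Finset.mem_univ _, ?_⟩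
    · split_ifs
      · exact mul_nonneg (mass_nonneg _ _ _) (mass_nonneg _ _ _)
      · exact le_rfl
    · rw [if_pos hp0]
      exact hqpos
  rw [hexp] at hsum
  linarith

end Information

/-! ### Converse -/

namespace Scheme

variable {F : Type u} {K N L LX LY Nr T : ℕ}

theorem law_apply [Fintype F] [Nonempty F] (s : Scheme F K N L LX LY)
    (w : Fin K → Fin L → F) (f : Fin K → s.UserRand) (z : Fin N → s.HelperRand) :
    s.law (w, f, z) = PMF.uniformOfFintype (Fin K → Fin L → F) w *
      (indepLaw s.userLaw f * s.helperLaw z) := by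
  classical
  rw [law, PMF.bind_apply, tsum_eq_single w fun w' hw => ?_]
  · congr 1
    rw [PMF.bind_apply, tsum_eq_single f fun f' hf => ?_]
    · congr 1
      rw [PMF.map_apply, tsum_eq_single z fun z' hz => ?_]
      · simp
      · simp [hz.symm]
    · simp [PMF.map_apply, hf.symm]
  · simp [PMF.bind_apply, PMF.map_apply, hw.symm]

theorem mem_support_law [Fintype F] [Nonempty F] (s : Scheme F K N L LX LY)
    (w : Fin K → Fin L → F) (f : Fin K → s.UserRand) (z : Fin N → s.HelperRand) :
    (w, f, z) ∈ s.law.support ↔ (∀ k, f k ∈ (s.userLaw k).support) ∧ z ∈ s.helperLaw.support := by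
  have h : indepLaw s.userLaw f ≠ 0 ↔ ∀ k, f k ∈ (s.userLaw k).support := by
    simp only [indepLaw, PMF.ofFintype_apply, PMF.mem_support_iff, ne_eq, Finset.prod_eq_zero_iff,
      Finset.mem_univ, true_and, not_exists]
  have hw : PMF.uniformOfFintype (Fin K → Fin L → F) w ≠ 0 := by
    simp [PMF.uniformOfFintype_apply]
  rw [← h, PMF.mem_support_iff, PMF.mem_support_iff, law_apply, mul_ne_zero_iff, mul_ne_zero_iff]
  exact ⟨fun h => h.2, fun h => ⟨hw, h⟩⟩

/-- The surviving helpers interact with nobody else: their responses are determined by the user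
messages addressed to them and by their stored variables. -/
theorem Y_congr (s : Scheme F K N L LX LY) {ν : Pattern K N} {ω ω' : s.Outcome}
    (hX : ∀ k, ∀ n ∈ ν.survivors, s.X k n ω = s.X k n ω')
    (hZ : ∀ n ∈ ν.survivors, s.Z n ω = s.Z n ω') {n : Fin N} (hn : n ∈ ν.survivors) :
    s.Y ν n ω = s.Y ν n ω' := by
  have hr : ∀ n ∈ ν.survivors, s.received ν n ω = s.received ν n ω' := fun n hn =>
    funext fun k => hX k n hn
  have hi : s.inbox ν n ω = s.inbox ν n ω' := funext fun i => by
    have := (Finset.mem_erase.1 i.2).2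
    simp only [inbox, M, hr i this, hZ i this]
  simp only [Y, hr n hn, hZ n hn, hi]

/-- The response of a helper is part of what it knows. -/
theorem Y_eq_of_helperView_eq (s : Scheme F K N L LX LY) {ν : Pattern K N} {𝒯 : Finset (Fin N)}
    {ω ω' : s.Outcome} (h : s.helperView ν 𝒯 ω = s.helperView ν 𝒯 ω') {n : Fin N} (hn : n ∈ 𝒯)
    (hn' : n ∈ ν.survivors) : s.Y ν n ω = s.Y ν n ω' := by
  simp only [helperView, Prod.mk.injEq] at h
  obtain ⟨hX, hZ, hM⟩ := h
  have hr : s.received ν n ω = s.received ν n ω' :=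
    funext fun k => congrFun (congrFun hX k) ⟨n, hn⟩
  have hz : s.Z n ω = s.Z n ω' := congrFun hZ ⟨n, hn⟩
  have hm : s.inbox ν n ω = s.inbox ν n ω' :=
    congrFun hM ⟨n, Finset.mem_inter.2 ⟨hn, hn'⟩⟩
  simp only [Y, hr, hz, hm]

theorem X_eq_of_helperView_eq (s : Scheme F K N L LX LY) {ν : Pattern K N} {𝒯 : Finset (Fin N)}
    {ω ω' : s.Outcome} (h : s.helperView ν 𝒯 ω = s.helperView ν 𝒯 ω') (k : Fin K) {n : Fin N}
    (hn : n ∈ 𝒯) : s.X k n ω = s.X k n ω' :=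
  congrFun (congrFun (Prod.mk.inj h).1 k) ⟨n, hn⟩

section Constraints

variable [Field F] [Fintype F]

theorem Correct.total_eq {s : Scheme F K N L LX LY} (hs : s.Correct Nr) {ν : Pattern K N}
    (hν : ν.Feasible Nr) {A : Finset (Fin N)} (hA : A ⊆ ν.survivors) (hc : Nr ≤ A.card)
    {ω ω' : s.Outcome} (hω : ω ∈ s.law.support) (hω' : ω' ∈ s.law.support)
    (h : ∀ n ∈ A, s.Y ν n ω = s.Y ν n ω') : s.total ω = s.total ω' :=
  eq_of_condEntropy_eq_zero (hs ν hν A hA hc) hω hω' (funext fun n => h n n.2)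

/-- A secure set of helpers may see the same thing whatever the gradients are. -/
theorem SecureHelpers.exists_gradients_eq {s : Scheme F K N L LX LY} (hs : s.SecureHelpers Nr T)
    {ν : Pattern K N} (hν : ν.Feasible Nr) {𝒯 : Finset (Fin N)} (hc : 𝒯.card ≤ T)
    {ω : s.Outcome} (hω : ω ∈ s.law.support) (w : Fin K → Fin L → F) :
    ∃ ω' ∈ s.law.support, ω'.1 = w ∧ s.helperView ν 𝒯 ω' = s.helperView ν 𝒯 ω := by
  have hmem : (w, ω.2.1, ω.2.2) ∈ s.law.support :=
    (s.mem_support_law _ _ _).2 ((s.mem_support_law ω.1 ω.2.1 ω.2.2).1 hω)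
  exact exists_of_condMutualInfo_eq_zero (hs ν hν ∅ 𝒯 hc) hmem hω

end Constraints

end Scheme

theorem sum_update_zero {F : Type*} [AddCommMonoid F] {K L : ℕ} (k : Fin K) (v : Fin L → F) :
    ∑ i, Function.update (0 : Fin K → Fin L → F) k v i = v := by
  rw [Finset.sum_eq_single k]
  · simp
  · intro i _ hi
    simp [hi]
  · simp

theorem Pattern.survivors_const {K N : ℕ} (hK : 1 ≤ K) (A : Finset (Fin N)) :
    Pattern.survivors (fun _ : Fin K => A) = A := by
  ext n
  simp only [Pattern.survivors, Finset.mem_biUnion, Finset.mem_univ, true_and]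
  exact ⟨fun ⟨_, h⟩ => h, fun h => ⟨⟨0, hK⟩, h⟩⟩

namespace Scheme

variable {F : Type u} [Field F] [Fintype F] {K N L LX LY Nr T : ℕ}

/-- If all users reach the same `Nr ≤ T` helpers, these helpers can recover the sum, so it would
have to be constant. -/
theorem threshold_lt (hK : 1 ≤ K) (hNrN : Nr ≤ N) {s : Scheme F K N L LX LY} (hL : 0 < L)
    (hc : s.Correct Nr) (hs : s.SecureHelpers Nr T) : T < Nr := by
  by_contra! hle
  obtain ⟨A, -, hA⟩ := Finset.exists_subset_card_eq (s := (Finset.univ : Finset (Fin N)))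
    (n := Nr) (by simpa using hNrN)
  have hν : Pattern.Feasible Nr (fun _ : Fin K => A) := fun _ => hA.ge
  obtain ⟨ω, hω⟩ := s.law.support_nonempty
  have key : ∀ v : Fin L → F, v = s.total ω := by
    intro v
    obtain ⟨ω', hω', hw, hv⟩ := hs.exists_gradients_eq hν (hA.le.trans hle) hω
      (Function.update 0 ⟨0, hK⟩ v)
    rw [← hc.total_eq hν (Pattern.survivors_const hK A).ge hA.ge hω' hω fun n hn =>
      s.Y_eq_of_helperView_eq hv hn (by rwa [Pattern.survivors_const hK]), total, hw,
      sum_update_zero]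
  have h01 := (key 0).trans (key 1).symm
  exact zero_ne_one (congrFun h01 ⟨0, hL⟩)

theorem card_le_of_injective {m d : ℕ} {A : Finset (Fin N)} (hA : A.card = d)
    {φ : (Fin L → F) → A → Fin m → F} (hφ : Function.Injective φ) : L ≤ m * d := by
  have h := Fintype.card_le_of_injective φ hφ
  simp only [Fintype.card_fun, Fintype.card_fin, Fintype.card_coe, hA, ← pow_mul] at h
  exact (Nat.pow_le_pow_iff_right Fintype.one_lt_card).1 h

/-- Once `T` of the `Nr` responses are fixed, the sum is still arbitrary, so that it has to be
carried by the remaining responses. -/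
theorem length_le_response (hK : 1 ≤ K) (hNrN : Nr ≤ N) (hT : T ≤ Nr)
    {s : Scheme F K N L LX LY} (hc : s.Correct Nr) (hs : s.SecureHelpers Nr T) :
    L ≤ LY * (Nr - T) := by
  obtain ⟨A, -, hA⟩ := Finset.exists_subset_card_eq (s := (Finset.univ : Finset (Fin N)))
    (n := Nr) (by simpa using hNrN)
  obtain ⟨𝒯, h𝒯A, h𝒯⟩ := Finset.exists_subset_card_eq (s := A) (n := T) (hA ▸ hT)
  have hν : Pattern.Feasible Nr (fun _ : Fin K => A) := fun _ => hA.ge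
  have hsurv := Pattern.survivors_const hK A
  obtain ⟨ω, hω⟩ := s.law.support_nonempty
  choose ω' hω' hw hv using fun v : Fin L → F =>
    hs.exists_gradients_eq hν h𝒯.le hω (Function.update 0 ⟨0, hK⟩ v)
  refine card_le_of_injective (A := A \ 𝒯) (m := LY)
    (φ := fun v n => s.Y (fun _ => A) n (ω' v))
    (by rw [Finset.card_sdiff_of_subset h𝒯A, hA, h𝒯]) fun v v' h => ?_
  have ht := hc.total_eq hν hsurv.ge hA.ge (hω' v) (hω' v') fun n hn => by
    by_cases hn' : n ∈ 𝒯
    · exact s.Y_eq_of_helperView_eq ((hv v).trans (hv v').symm) hn' (by rwa [hsurv])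
    · exact congrFun h ⟨n, Finset.mem_sdiff.2 ⟨hn, hn'⟩⟩
  simpa only [total, hw, sum_update_zero] using ht

/-- Fix the other users, the variables of all helpers and the messages of one user to `T` helpers.
Since the stored variables are independent of the users, the gradient of that user is still
arbitrary, so that it has to be carried by its messages to the remaining helpers. -/
theorem length_le_upload (hK : 1 ≤ K) (hNrN : Nr ≤ N) (hT : T ≤ Nr)
    {s : Scheme F K N L LX LY} (hc : s.Correct Nr) (hs : s.SecureHelpers Nr T) :
    L ≤ LX * (Nr - T) := by
  obtain ⟨A, -, hA⟩ := Finset.exists_subset_card_eq (s := (Finset.univ : Finset (Fin N)))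
    (n := Nr) (by simpa using hNrN)
  obtain ⟨𝒯, h𝒯A, h𝒯⟩ := Finset.exists_subset_card_eq (s := A) (n := T) (hA ▸ hT)
  have hν : Pattern.Feasible Nr (fun _ : Fin K => A) := fun _ => hA.ge
  have hsurv := Pattern.survivors_const hK A
  obtain ⟨ω, hω⟩ := s.law.support_nonempty
  have hω0 := (s.mem_support_law ω.1 ω.2.1 ω.2.2).1 hω
  set k₀ : Fin K := ⟨0, hK⟩
  choose ω' hω' hw hv using fun v : Fin L → F =>
    hs.exists_gradients_eq hν h𝒯.le hω (Function.update 0 k₀ v)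
  -- The user `k₀` behaves as in `ω' v`, everybody else as in `ω`.
  let τ : (Fin L → F) → s.Outcome := fun v =>
    (Function.update 0 k₀ v, Function.update ω.2.1 k₀ ((ω' v).2.1 k₀), ω.2.2)
  have hτ : ∀ v, τ v ∈ s.law.support := fun v => by
    refine (s.mem_support_law _ _ _).2 ⟨fun k => ?_, hω0.2⟩
    by_cases hk : k = k₀
    · rw [hk, Function.update_self]
      exact ((s.mem_support_law (ω' v).1 (ω' v).2.1 (ω' v).2.2).1 (hω' v)).1 k₀
    · rw [Function.update_of_ne hk]
      exact hω0.1 k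
  have hX : ∀ v n, s.X k₀ n (τ v) = s.X k₀ n (ω' v) := fun v n => by
    simp [X, τ, hw]
  refine card_le_of_injective (A := A \ 𝒯) (m := LX)
    (φ := fun v n => s.X k₀ n (τ v))
    (by rw [Finset.card_sdiff_of_subset h𝒯A, hA, h𝒯]) fun v v' h => ?_
  have ht := hc.total_eq hν hsurv.ge hA.ge (hτ v) (hτ v') fun n hn => by
    refine s.Y_congr (ω := τ v) (ω' := τ v') (fun k i hi => ?_) (fun i _ => rfl) (by rwa [hsurv])
    by_cases hk : k = k₀
    · rw [hk]
      by_cases hi' : i ∈ 𝒯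
      · rw [hX, hX]
        exact s.X_eq_of_helperView_eq ((hv v).trans (hv v').symm) _ hi'
      · exact congrFun h ⟨i, Finset.mem_sdiff.2 ⟨hsurv ▸ hi, hi'⟩⟩
    · simp [X, τ, hk]
  simpa only [total, τ, sum_update_zero] using ht

end Scheme

/-! ### Ramp secret sharing -/

/-- A linear ramp secret sharing scheme over `F`: a secret in `F ^ L` and a mask in `(F ^ m) ^ T` are
encoded into `N` shares in `F ^ m`, such that any `Nr` shares determine the secret and all other
shares, while any `T` shares say nothing about the secret. The last property is expressed by a
linear map that chooses, for each secret, a mask for which these `T` shares vanish. -/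
structure RampSharing (F : Type u) [Field F] (N Nr T L m : ℕ) where
  /-- The share of a helper, as a function of the secret and of the mask. -/
  share : Fin N → (Fin L → F) × (Fin T → Fin m → F) →ₗ[F] (Fin m → F)
  /-- `repair A n i` is the contribution of the share of `i ∈ A` to the share of `n`. -/
  repair : Finset (Fin N) → Fin N → Fin N → (Fin m → F) →ₗ[F] (Fin m → F)
  sum_repair : ∀ A : Finset (Fin N), Nr ≤ A.card → ∀ n x,
    ∑ i ∈ A, repair A n i (share i x) = share n x
  secret_eq_zero : ∀ A : Finset (Fin N), Nr ≤ A.card → ∀ x, (∀ i ∈ A, share i x = 0) → x.1 = 0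
  exists_mask : ∀ A : Finset (Fin N), A.card ≤ T →
    ∃ g : (Fin L → F) →ₗ[F] (Fin T → Fin m → F), ∀ w, ∀ i ∈ A, share i (w, g w) = 0

theorem RampSharing.sum_share {F : Type u} [Field F] {K N Nr T L m : ℕ}
    (c : RampSharing F N Nr T L m) (n : Fin N) (w : Fin K → Fin L → F)
    (f : Fin K → Fin T → Fin m → F) :
    ∑ k, c.share n (w k, f k) = c.share n (∑ k, w k, ∑ k, f k) := by
  rw [← map_sum]
  congr 1
  ext1 <;> simp [Prod.fst_sum, Prod.snd_sum]

section Lagrange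

open Polynomial

variable {E : Type*} [Field E] {N a T : ℕ}

/-- The polynomial of degree less than `a + T` with values `x.1` at the `a` points `β (inl i)` and
`x.2` at the `T` points `β (inr j)`. -/
noncomputable def encode (β : Fin a ⊕ Fin T → E) : (Fin a → E) × (Fin T → E) →ₗ[E] E[X] where
  toFun x := Lagrange.interpolate Finset.univ β (Sum.elim x.1 x.2)
  map_add' x y := by
    rw [← map_add]
    congr 1
    ext (i | i) <;> simp
  map_smul' c x := by
    rw [RingHom.id_apply, ← map_smul]
    congr 1
    ext (i | i) <;> simp

theorem degree_encode_lt {β : Fin a ⊕ Fin T → E} (hβ : Function.Injective β)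
    (x : (Fin a → E) × (Fin T → E)) : (encode β x).degree < (a + T : ℕ) := by
  have h := Lagrange.degree_interpolate_lt (s := Finset.univ) (Sum.elim x.1 x.2) hβ.injOn
  rwa [Finset.card_univ, Fintype.card_sum, Fintype.card_fin, Fintype.card_fin] at h

theorem eval_encode_inl {β : Fin a ⊕ Fin T → E} (hβ : Function.Injective β)
    (x : (Fin a → E) × (Fin T → E)) (i : Fin a) : (encode β x).eval (β (.inl i)) = x.1 i :=
  Lagrange.eval_interpolate_at_node _ hβ.injOn (Finset.mem_univ _)

theorem sum_basis_mul_eval {α : Fin N → E} (hα : Function.Injective α) {A : Finset (Fin N)}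
    {p : E[X]} (hp : p.degree < A.card) (y : E) :
    ∑ i ∈ A, (Lagrange.basis A α i).eval y * p.eval (α i) = p.eval y := by
  conv_rhs => rw [Lagrange.eq_interpolate (s := A) hα.injOn hp, Lagrange.interpolate_apply]
  simp [eval_finsetSum, mul_comm]

/-- Interpolating the secret at the points `β (inl i)` and zero at `T` of the points `α n` gives the
mask that hides these `T` shares. -/
theorem exists_linear_mask {β : Fin a ⊕ Fin T → E} (hβ : Function.Injective β) {α : Fin N → E}
    (hα : Function.Injective α) (hαβ : ∀ n i, α n ≠ β i) {A : Finset (Fin N)} (hA : A.card = T) :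
    ∃ g : (Fin a → E) →ₗ[E] (Fin T → E), ∀ w, ∀ n ∈ A, (encode β (w, g w)).eval (α n) = 0 := by
  classical
  let γ : Fin a ⊕ Fin T → E :=
    Sum.elim (fun i => β (.inl i)) fun j => α (A.orderEmbOfFin hA j)
  have hγ : Function.Injective γ := by
    rintro (i | i) (j | j) h
    · exact congrArg _ (Sum.inl_injective (hβ h))
    · exact absurd h.symm (hαβ _ _)
    · exact absurd h (hαβ _ _)
    · exact congrArg _ ((A.orderEmbOfFin hA).injective (hα h))
  refine ⟨LinearMap.pi fun j => (leval (β (.inr j))) ∘ₗ encode γ ∘ₗ LinearMap.inl E _ _,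
    fun w n hn => ?_⟩
  have heq : encode γ (w, 0) = encode β (w, LinearMap.pi
      (fun j => (leval (β (.inr j))) ∘ₗ encode γ ∘ₗ LinearMap.inl E _ _) w) := by
    refine Lagrange.eq_interpolate_of_eval_eq (s := Finset.univ) _ hβ.injOn ?_ ?_
    · rw [Finset.card_univ, Fintype.card_sum, Fintype.card_fin, Fintype.card_fin]
      exact degree_encode_lt hγ (w, 0)
    · rintro (i | j) -
      · exact eval_encode_inl hγ (w, 0) i
      · simp [leval]
  rw [← heq]
  obtain ⟨j, rfl⟩ : ∃ j, A.orderEmbOfFin hA j = n := by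
    rw [← Set.mem_range, Finset.range_orderEmbOfFin]
    exact hn
  exact Lagrange.eval_interpolate_at_node (s := Finset.univ) (i := Sum.inr j) _ hγ.injOn
    (Finset.mem_univ _)

end Lagrange

/-- Ramp sharing exists whenever the secret is `Nr - T` times as long as a share and shares are
long enough for the field extension of degree `m` to contain `Nr + N` evaluation points. -/
theorem exists_rampSharing (F : Type u) [Field F] [Fintype F] {N Nr T : ℕ} (hTN : T ≤ N)
    (hNr : T ≤ Nr) :
    ∃ m, 0 < m ∧ Nonempty (RampSharing F N Nr T ((Nr - T) * m) m) := by
  classical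
  obtain ⟨a, rfl⟩ := Nat.exists_eq_add_of_le' hNr
  rw [Nat.add_sub_cancel]
  obtain ⟨p, hp⟩ := CharP.exists F
  have : Fact p.Prime := ⟨CharP.char_is_prime F p⟩
  -- `q ^ m > m` leaves room for `a + T + N` distinct evaluation points.
  let m := a + T + N + 1
  refine ⟨m, Nat.succ_pos _, ?_⟩
  let E := FiniteField.Extension F p m
  have hrank : Module.finrank F E = m := FiniteField.finrank_extension F p m
  have hcard : a + T + N ≤ Nat.card E := by
    rw [FiniteField.natCard_extension F p m]
    exact ((Nat.le_succ _).trans (Nat.lt_pow_self (n := m) (by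
      rw [Nat.card_eq_fintype_card]; exact Fintype.one_lt_card)).le)
  have := Fintype.ofFinite E
  obtain ⟨pt⟩ : Nonempty ((Fin a ⊕ Fin T) ⊕ Fin N ↪ E) := by
    refine Function.Embedding.nonempty_of_card_le ?_
    rw [← Nat.card_eq_fintype_card (α := E)]
    simpa using hcard
  let β : Fin a ⊕ Fin T → E := fun i => pt (.inl i)
  let α : Fin N → E := fun n => pt (.inr n)
  have hβ : Function.Injective β := pt.injective.comp Sum.inl_injective
  have hα : Function.Injective α := pt.injective.comp Sum.inr_injective
  have hαβ : ∀ n i, α n ≠ β i := fun n i h => by simpa using pt.injective h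
  let e : (Fin m → F) ≃ₗ[F] E := LinearEquiv.ofFinrankEq _ _ (by rw [Module.finrank_fin_fun, hrank])
  let e' : (Fin (a * m) → F) ≃ₗ[F] (Fin a → E) := LinearEquiv.ofFinrankEq _ _ (by
    rw [Module.finrank_fin_fun, Module.finrank_pi_fintype, hrank]; simp)
  let en : (Fin (a * m) → F) × (Fin T → Fin m → F) →ₗ[F] Polynomial E :=
    (encode β).restrictScalars F ∘ₗ
      (LinearMap.prodMap e'.toLinearMap (LinearEquiv.piCongrRight fun _ : Fin T => e).toLinearMap)
  have hen : ∀ x, en x = encode β (e' x.1, fun j => e (x.2 j)) := fun x => rfl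
  have hdeg : ∀ x {A : Finset (Fin N)}, a + T ≤ A.card → (en x).degree < A.card := fun x A hA =>
    (degree_encode_lt hβ _).trans_le (by exact_mod_cast hA)
  let share : Fin N → (Fin (a * m) → F) × (Fin T → Fin m → F) →ₗ[F] (Fin m → F) := fun n =>
    e.symm.toLinearMap ∘ₗ (Polynomial.leval (α n)).restrictScalars F ∘ₗ en
  have hshare : ∀ n x, e (share n x) = (en x).eval (α n) := fun n x => by simp [share]
  refine ⟨⟨share, fun A n i => e.symm.toLinearMap ∘ₗ
    (LinearMap.mulLeft F ((Lagrange.basis A α i).eval (α n))) ∘ₗ e.toLinearMap, ?_, ?_, ?_⟩⟩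
  · intro A hA n x
    apply e.injective
    rw [map_sum, hshare, ← sum_basis_mul_eval hα (hdeg x hA) (α n)]
    refine Finset.sum_congr rfl fun i _ => ?_
    simp [← hshare]
  · intro A hA x hx
    have h0 : en x = 0 := Polynomial.eq_zero_of_degree_lt_of_eval_index_eq_zero A hα.injOn
      (hdeg x hA) fun i hi => by rw [← hshare, hx i hi, map_zero]
    apply e'.injective
    ext i
    have h := eval_encode_inl hβ (e' x.1, fun j => e (x.2 j)) i
    rw [← hen, h0, Polynomial.eval_zero] at h
    simpa using h.symm
  · intro A hA
    obtain ⟨B, hAB, hB⟩ := Finset.exists_superset_card_eq hA (by simpa using hTN)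
    obtain ⟨g, hg⟩ := exists_linear_mask hβ hα hαβ hB
    refine ⟨(LinearEquiv.piCongrRight fun _ : Fin T => e.symm).toLinearMap ∘ₗ
      g.restrictScalars F ∘ₗ e'.toLinearMap, fun w i hi => ?_⟩
    apply e.injective
    rw [hshare, hen, map_zero, ← hg (e' w) i (hAB hi)]
    simp

/-! ### The optimal scheme -/

/-- Families of masks `z i ν n`, used by helper `i` in its message to helper `n` under the pattern
`ν`, that cancel when summed over all surviving helpers `i`. -/
noncomputable def zeroSumMasks (K N : ℕ) (V : Type*) [AddCommGroup V] [Fintype V] :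
    Finset (Fin N → Pattern K N → Fin N → V) :=
  open Classical in
  Finset.univ.filter fun z => ∀ ν n, ∑ i ∈ Pattern.survivors ν, z i ν n = 0

theorem mem_zeroSumMasks {K N : ℕ} {V : Type*} [AddCommGroup V] [Fintype V]
    {z : Fin N → Pattern K N → Fin N → V} :
    z ∈ zeroSumMasks K N V ↔ ∀ ν n, ∑ i ∈ Pattern.survivors ν, z i ν n = 0 := by
  simp [zeroSumMasks]

theorem zeroSumMasks_nonempty (K N : ℕ) (V : Type*) [AddCommGroup V] [Fintype V] :
    (zeroSumMasks K N V).Nonempty :=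
  ⟨0, mem_zeroSumMasks.2 fun _ _ => by simp⟩

theorem add_mem_zeroSumMasks_iff {K N : ℕ} {V : Type*} [AddCommGroup V] [Fintype V]
    {z z₀ : Fin N → Pattern K N → Fin N → V} (h : z₀ ∈ zeroSumMasks K N V) :
    z + z₀ ∈ zeroSumMasks K N V ↔ z ∈ zeroSumMasks K N V := by
  simp only [mem_zeroSumMasks, Pi.add_apply, Finset.sum_add_distrib, mem_zeroSumMasks.1 h, add_zero]

/-- A sum over surviving helpers and the users that they hear, in the other order. -/
theorem Pattern.sum_survivors_heard {K N : ℕ} {V : Type*} [AddCommMonoid V] (ν : Pattern K N)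
    (φ : Fin N → Fin K → V) :
    ∑ i ∈ ν.survivors, ∑ k ∈ ν.heard i, φ i k = ∑ k, ∑ i ∈ ν k, φ i k :=
  Finset.sum_comm' fun i k => by
    simp only [Pattern.survivors, Pattern.heard, Finset.mem_biUnion, Finset.mem_filter,
      Finset.mem_univ, true_and, and_true]
    exact ⟨fun h => h.2, fun h => ⟨⟨k, h⟩, h⟩⟩

namespace RampSharing

variable {F : Type u} [Field F] [Fintype F] {K N Nr T L m : ℕ}

/-- The aggregation scheme built from ramp sharing: the upload of a user to helper `n` is the `n`-th
share of its gradient. Under a pattern `ν` each surviving helper contributes to the `n`-th share of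
the sum its part of the repair of the `n`-th shares of the users that it hears, hidden by masks that
cancel in the sum over all survivors. The response of helper `n` is the `n`-th share of the sum of
all gradients. -/
noncomputable abbrev scheme (c : RampSharing F N Nr T L m) : Scheme F K N L m m where
  UserRand := Fin T → Fin m → F
  HelperRand := Pattern K N → Fin N → Fin m → F
  Msg := Fin m → F
  userLaw _ := PMF.uniformOfFintype _
  helperLaw := PMF.uniformOfFinset _ (zeroSumMasks_nonempty K N (Fin m → F))
  upload _ n w r := c.share n (w, r)
  share ν n n' x z := ∑ k : ν.heard n, c.repair (ν k) n' n (x k) + z ν n'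
  respond ν n x z y := (∑ k : ν.heard n, c.repair (ν k) n n (x k) + z ν n) + ∑ i, y i

/-- The outcomes of `RampSharing.scheme`, as an additive group. -/
abbrev Coords (F : Type u) (K N T L m : ℕ) : Type u :=
  (Fin K → Fin L → F) × (Fin K → Fin T → Fin m → F) × (Fin N → Pattern K N → Fin N → Fin m → F)

variable (c : RampSharing F N Nr T L m)

theorem scheme_law_add (ω d : Coords F K N T L m)
    (hd : d.2.2 ∈ zeroSumMasks K N (Fin m → F)) :
    (c.scheme (K := K)).law (ω + d) = (c.scheme (K := K)).law ω := by
  obtain ⟨w, f, z⟩ := ω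
  obtain ⟨w₀, f₀, z₀⟩ := d
  refine ((c.scheme (K := K)).law_apply (w + w₀) (f + f₀) (z + z₀)).trans
    (Eq.trans ?_ ((c.scheme (K := K)).law_apply w f z).symm)
  refine congrArg₂ _ ?_ (congrArg₂ _ ?_ ?_)
  · simp only [PMF.uniformOfFintype_apply]
  · simp [indepLaw, PMF.ofFintype_apply, PMF.uniformOfFintype_apply]
  change PMF.uniformOfFinset _ (zeroSumMasks_nonempty K N (Fin m → F)) _ =
    PMF.uniformOfFinset _ (zeroSumMasks_nonempty K N (Fin m → F)) _
  rw [PMF.uniformOfFinset_apply, PMF.uniformOfFinset_apply]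
  have hmem := add_mem_zeroSumMasks_iff (z := z) hd
  by_cases h : z ∈ zeroSumMasks K N (Fin m → F)
  · rw [if_pos (hmem.2 h), if_pos h]
  · rw [if_neg (mt hmem.1 h), if_neg h]

theorem sum_zero_of_mem_support {ω : Coords F K N T L m}
    (h : ω ∈ (c.scheme (K := K)).law.support) (ν : Pattern K N) (n : Fin N) :
    ∑ i ∈ ν.survivors, ω.2.2 i ν n = 0 := by
  have h1 := (((c.scheme (K := K)).mem_support_law ω.1 ω.2.1 ω.2.2).1 h).2
  exact mem_zeroSumMasks.1 
    ((PMF.mem_support_uniformOfFinset_iff (zeroSumMasks_nonempty K N (Fin m → F)) _).1 h1) ν n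

theorem scheme_X (k : Fin K) (n : Fin N) (ω : Coords F K N T L m) :
    (c.scheme (K := K)).X k n ω = c.share n (ω.1 k, ω.2.1 k) := rfl

theorem scheme_M (ν : Pattern K N) (i n : Fin N) (ω : Coords F K N T L m) :
    (c.scheme (K := K)).M ν i n ω =
      ∑ k ∈ ν.heard i, c.repair (ν k) n i (c.share i (ω.1 k, ω.2.1 k)) + ω.2.2 i ν n := by
  rw [← Finset.sum_coe_sort]
  rfl

theorem scheme_Y {ν : Pattern K N} (hν : ν.Feasible Nr) {n : Fin N} (hn : n ∈ ν.survivors)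
    (ω : Coords F K N T L m) :
    (c.scheme (K := K)).Y ν n ω =
      ∑ k, c.share n (ω.1 k, ω.2.1 k) + ∑ i ∈ ν.survivors, ω.2.2 i ν n := by
  have h : (c.scheme (K := K)).Y ν n ω = (c.scheme (K := K)).M ν n n ω +
      ∑ i : ν.survivors.erase n, (c.scheme (K := K)).M ν i n ω := rfl
  rw [h, Finset.sum_coe_sort (ν.survivors.erase n) fun i => (c.scheme (K := K)).M ν i n ω]
  rw [Finset.add_sum_erase _ (fun i => (c.scheme (K := K)).M ν i n ω) hn]
  simp only [scheme_M]
  rw [Finset.sum_add_distrib, Pattern.sum_survivors_heard ν fun i k =>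
    c.repair (ν k) n i (c.share i (ω.1 k, ω.2.1 k))]
  simp only [c.sum_repair _ (hν _)]

theorem scheme_correct : (c.scheme (K := K)).Correct Nr := by
  intro ν hν A hA hc
  refine condEntropy_eq_zero fun (ω : Coords F K N T L m) hω
    (ω' : Coords F K N T L m) hω' h => ?_
  have hzero := c.secret_eq_zero A hc
    ((∑ k, ω.1 k, ∑ k, ω.2.1 k) - (∑ k, ω'.1 k, ∑ k, ω'.2.1 k)) fun n hn => by
      have h1 := congrFun h ⟨n, hn⟩
      change (c.scheme (K := K)).Y ν n ω = (c.scheme (K := K)).Y ν n ω' at h1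
      rw [c.scheme_Y hν (hA hn), c.scheme_Y hν (hA hn), c.sum_zero_of_mem_support hω,
        c.sum_zero_of_mem_support hω', add_zero, add_zero, c.sum_share, c.sum_share] at h1
      rw [map_sub, h1, sub_self]
  exact sub_eq_zero.1 hzero

/-- Any change `δ` of the gradients can be compensated by a change of the randomness that is not
noticed by `T` helpers, nor, if `δ` sums to zero, by the master. Users with the same gradient as
before keep their randomness. -/
theorem exists_compensation (ν : Pattern K N) (hν : ν.Feasible Nr) {𝒯 : Finset (Fin N)}
    (h𝒯 : 𝒯.card ≤ T) (δ : Fin K → Fin L → F) :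
    ∃ d : Coords F K N T L m, d.1 = δ ∧ d.2.2 ∈ zeroSumMasks K N (Fin m → F) ∧
      (∀ k, δ k = 0 → d.2.1 k = 0) ∧
      (∀ ω : Coords F K N T L m,
        (c.scheme (K := K)).helperView ν 𝒯 (ω + d) = (c.scheme (K := K)).helperView ν 𝒯 ω) ∧
      (∑ k, δ k = 0 → ∀ n, ∑ k, c.share n (d.1 k, d.2.1 k) = 0) := by
  classical
  obtain ⟨g, hg⟩ := c.exists_mask 𝒯 h𝒯
  -- The masks sent to `n ∈ 𝒯` absorb the change of the repair messages.
  let z₀ : Fin N → Pattern K N → Fin N → Fin m → F := fun i ν' n =>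
    if ν' = ν ∧ n ∈ 𝒯 then
      -∑ k ∈ ν.heard i, c.repair (ν k) n i (c.share i (δ k, g (δ k))) else 0
  have hshare : ∀ (ω : Coords F K N T L m) k n,
      c.share n ((ω + (δ, (fun k => g (δ k)), z₀)).1 k, (ω + (δ, (fun k => g (δ k)), z₀)).2.1 k) =
        c.share n (ω.1 k, ω.2.1 k) + c.share n (δ k, g (δ k)) := fun ω k n => by
    rw [← map_add]
    rfl
  refine ⟨(δ, fun k => g (δ k), z₀), rfl, ?_, ?_, ?_, ?_⟩
  · refine mem_zeroSumMasks.2 fun ν' n => ?_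
    by_cases h : ν' = ν ∧ n ∈ 𝒯
    · obtain ⟨rfl, hn⟩ := h
      simp only [z₀, hn, and_self, if_true]
      rw [Finset.sum_neg_distrib, Pattern.sum_survivors_heard ν' fun i k =>
        c.repair (ν' k) n i (c.share i (δ k, g (δ k)))]
      simp only [c.sum_repair _ (hν _), hg _ n hn, Finset.sum_const_zero, neg_zero]
    · simp only [z₀, h, if_false, Finset.sum_const_zero]
  · intro k hk
    simp only [hk, map_zero]
  · intro ω
    have hX : (fun (k : Fin K) (n : 𝒯) =>
        (c.scheme (K := K)).X k n (ω + (δ, (fun k => g (δ k)), z₀))) =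
        fun k (n : 𝒯) => (c.scheme (K := K)).X k n ω := by
      funext k n
      rw [scheme_X, scheme_X, hshare, hg _ n n.2, add_zero]
    have hZ : (fun n : 𝒯 => (c.scheme (K := K)).Z n (ω + (δ, (fun k => g (δ k)), z₀))) =
        fun n : 𝒯 => (c.scheme (K := K)).Z n ω := by
      funext n
      have hz : z₀ n = 0 := by
        funext ν' n'
        simp only [z₀, hg _ n n.2, map_zero, Finset.sum_const_zero, neg_zero, ite_self,
          Pi.zero_apply]
      change ω.2.2 n + z₀ n = ω.2.2 n
      rw [hz, add_zero]
    have hM : (fun n : ↥(𝒯 ∩ ν.survivors) =>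
        (c.scheme (K := K)).inbox ν n (ω + (δ, (fun k => g (δ k)), z₀))) =
        fun n : ↥(𝒯 ∩ ν.survivors) => (c.scheme (K := K)).inbox ν n ω := by
      funext n i
      have hn : (n : Fin N) ∈ 𝒯 := (Finset.mem_inter.1 n.2).1
      change (c.scheme (K := K)).M ν i n _ = (c.scheme (K := K)).M ν i n _
      rw [scheme_M, scheme_M]
      simp only [hshare, map_add, Finset.sum_add_distrib]
      change _ + (ω.2.2 i ν n + z₀ i ν n) = _
      simp only [z₀, hn, and_self, if_true]
      abel
    exact Prod.ext hX (Prod.ext hZ hM)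
  · intro h n
    change ∑ k, c.share n (δ k, g (δ k)) = 0
    rw [c.sum_share n δ fun k => g (δ k), ← map_sum, h, map_zero]
    exact map_zero (c.share n)

theorem userView_add {𝒰 : Finset (Fin K)} {ω₁ ω₂ d : Coords F K N T L m}
    (h : (c.scheme (K := K)).userView 𝒰 ω₁ = (c.scheme (K := K)).userView 𝒰 ω₂)
    (hd : d.1 = ω₂.1 - ω₁.1) (hd' : ∀ k, (ω₂.1 - ω₁.1) k = 0 → d.2.1 k = 0)
    (ω : Coords F K N T L m) :
    (c.scheme (K := K)).userView 𝒰 (ω + d) = (c.scheme (K := K)).userView 𝒰 ω := by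
  have h0 : ∀ k ∈ 𝒰, (ω₂.1 - ω₁.1) k = 0 := fun k hk =>
    sub_eq_zero.2 (congrFun (Prod.mk.inj h).1 ⟨k, hk⟩).symm
  refine Prod.ext (funext fun k => ?_) (funext fun k => ?_)
  · change ω.1 k + d.1 k = ω.1 k
    rw [hd, h0 k k.2, add_zero]
  · change ω.2.1 k + d.2.1 k = ω.2.1 k
    rw [hd' k (h0 k k.2), add_zero]

theorem scheme_secureHelpers : (c.scheme (K := K)).SecureHelpers Nr T := by
  intro ν hν 𝒰 𝒯 h𝒯
  refine condMutualInfo_eq_zero fun (ω₁ : Coords F K N T L m) (ω₂ : Coords F K N T L m) h => ?_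
  obtain ⟨d, hd, hz, hf, hview, -⟩ := c.exists_compensation ν hν h𝒯 (ω₂.1 - ω₁.1)
  refine ⟨Equiv.addRight d, fun ω => c.scheme_law_add ω d hz, fun ω hω => ?_,
    fun ω => ⟨hview ω, c.userView_add h hd hf ω⟩⟩
  change ω.1 = ω₁.1 at hω
  change ω.1 + d.1 = ω₂.1
  rw [hd, hω, add_sub_cancel]

theorem scheme_secureMaster : (c.scheme (K := K)).SecureMaster Nr T := by
  intro ν hν 𝒰 𝒯 h𝒯
  refine condMutualInfo_eq_zero fun (ω₁ : Coords F K N T L m) (ω₂ : Coords F K N T L m) h => ?_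
  obtain ⟨ht, hu⟩ := Prod.mk.inj h
  obtain ⟨d, hd, hz, hf, hview, hresp⟩ := c.exists_compensation ν hν h𝒯 (ω₂.1 - ω₁.1)
  have hsum : ∑ k, (ω₂.1 - ω₁.1) k = 0 := by
    simp only [Pi.sub_apply, Finset.sum_sub_distrib]
    exact sub_eq_zero.2 ht.symm
  refine ⟨Equiv.addRight d, fun ω => c.scheme_law_add ω d hz, fun ω hω => ?_,
    fun ω => ⟨Prod.ext (funext fun n => ?_) (hview ω), Prod.ext ?_ (c.userView_add hu hd hf ω)⟩⟩
  · change ω.1 = ω₁.1 at hω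
    change ω.1 + d.1 = ω₂.1
    rw [hd, hω, add_sub_cancel]
  · change (c.scheme (K := K)).Y ν n (ω + d) = (c.scheme (K := K)).Y ν n ω
    rw [c.scheme_Y hν n.2, c.scheme_Y hν n.2]
    have h1 : ∀ k, c.share n ((ω + d).1 k, (ω + d).2.1 k) =
        c.share n (ω.1 k, ω.2.1 k) + c.share n (d.1 k, d.2.1 k) := fun k => by
      rw [← map_add]
      rfl
    have h2 : ∀ i, (ω + d).2.2 i ν n = ω.2.2 i ν n + d.2.2 i ν n := fun i => rfl
    simp only [h1, h2, Finset.sum_add_distrib, hresp hsum, mem_zeroSumMasks.1 hz, add_zero]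
  · change ∑ k, (ω.1 k + d.1 k) = ∑ k, ω.1 k
    rw [Finset.sum_add_distrib, hd, hsum, add_zero]

end RampSharing

end SecureAggregation

theorem theorem1 {F : Type*} [Field F] [Fintype F] (K N Nr T : ℕ)
    (hK : 1 ≤ K) (hNr : 1 ≤ Nr) (hNrN : Nr + 1 ≤ N) (hT : 1 ≤ T) (hTN : T ≤ N) :
    (Nr ≤ T → SecureAggregation.optimalRegion F K N Nr T = ∅) ∧
    (T < Nr → SecureAggregation.optimalRegion F K N Nr T =
      {R : ℝ × ℝ | 1 / ((Nr : ℝ) - (T : ℝ)) ≤ R.1 ∧ 1 / ((Nr : ℝ) - (T : ℝ)) ≤ R.2}) := by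
  have hNrN' : Nr ≤ N := (Nat.le_succ _).trans hNrN
  constructor
  · intro hle
    rw [SecureAggregation.optimalRegion, closure_empty_iff, Set.eq_empty_iff_forall_notMem]
    rintro R ⟨L, LX, LY, s, hL, hc, hs, -, -, -⟩
    exact absurd (SecureAggregation.Scheme.threshold_lt hK hNrN' hL hc hs) hle.not_gt
  · intro hlt
    have hpos : (0 : ℝ) < (Nr : ℝ) - (T : ℝ) := sub_pos.2 (by exact_mod_cast hlt)
    have hset : {R : ℝ × ℝ | SecureAggregation.Achievable F K N Nr T R} =
        {R : ℝ × ℝ | 1 / ((Nr : ℝ) - (T : ℝ)) ≤ R.1 ∧ 1 / ((Nr : ℝ) - (T : ℝ)) ≤ R.2} := by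
      have hrate : ∀ {L l : ℕ} {r : ℝ}, 0 < L → L ≤ l * (Nr - T) → (l : ℝ) / L ≤ r →
          1 / ((Nr : ℝ) - (T : ℝ)) ≤ r := by
        intro L l r hL hl hr
        refine le_trans ?_ hr
        have hl' : (L : ℝ) ≤ l * ((Nr : ℝ) - T) := by
          rw [← Nat.cast_sub hlt.le]
          exact_mod_cast hl
        rw [div_le_div_iff₀ hpos (by exact_mod_cast hL), one_mul]
        exact hl'
      ext R
      constructor
      · rintro ⟨L, LX, LY, s, hL, hc, hs, -, hX, hY⟩
        exact ⟨hrate hL (SecureAggregation.Scheme.length_le_upload hK hNrN' hlt.le hc hs) hX,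
          hrate hL (SecureAggregation.Scheme.length_le_response hK hNrN' hlt.le hc hs) hY⟩
      · rintro ⟨hX, hY⟩
        obtain ⟨m, hm, ⟨c⟩⟩ := SecureAggregation.exists_rampSharing F hTN hlt.le
        have hm' : (m : ℝ) ≠ 0 := by exact_mod_cast hm.ne'
        have hr : (m : ℝ) / (((Nr - T) * m : ℕ) : ℝ) = 1 / ((Nr : ℝ) - (T : ℝ)) := by
          rw [Nat.cast_mul, Nat.cast_sub hlt.le]
          field_simp
        exact ⟨(Nr - T) * m, m, m, c.scheme, Nat.mul_pos (Nat.sub_pos_of_lt hlt) hm,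
          c.scheme_correct, c.scheme_secureHelpers, c.scheme_secureMaster, hr.trans_le hX,
          hr.trans_le hY⟩
    rw [SecureAggregation.optimalRegion, hset]
    exact ((isClosed_le continuous_const continuous_fst).inter
      (isClosed_le continuous_const continuous_snd)).closure_eq
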